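/- Let $\mathcal B_n$ be the hyperoctahedral group of signed permutations, i.e. the permutations $\pi$ of $\pm[n]=\{\pm1,\ldots,\pm n\}$ with $\pi(-i)=-\pi(i)$ for all $i$. Identify $\pi$ with the word $\pi(0)\pi(1)\cdots\pi(n)$, where $\pi(0)=0$. A run of $\pi$ is a maximal consecutive subword of this word that is monotonic (increasing or decreasing) in the usual order of the integers. Let $T(n,k)$ be the number of $\pi\in\mathcal B_n$ with $\pi(1)>0$ that have exactly $k$ runs, and let $T_n(x)=\sum_{k=1}^n T(n,k)x^k$. For $n\geqslant 1$ let $$t_n(x)=\begin{cases}(1+x)(1-x^2)^{k-1}, & \text{if } n=2k-1,\\ -(1-x^2)^k, & \text{if } n=2k.\end{cases}$$ Then for every $n\geqslant 1$, as an identity of rational functions, $$T_n(x)=\frac{x}{1+x}\,t_n(x)+\sum_{r=2}^n\binom{n}{r-1}t_{n-r+1}(x)\,T_{r-1}(x).$$ Moreover, for every $n\geqslant 1$, $T_n(x)$ is a nonzero polynomial and the multiplicity of $-1$ as a root of $T_n(x)$ is exactly $\left\lfloor\frac{n-1}{2}\right\rfloor$. -/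

import Mathlib

open Polynomial

/-- The set `±[n] = {±1, ±2, …, ±n}`. -/
noncomputable def plusMinus (n : ℕ) : Finset ℤ := (Finset.Icc (-(n : ℤ)) (n : ℤ)).erase 0

theorem neg_mem_plusMinus {n : ℕ} {i : ℤ} (h : i ∈ plusMinus n) : -i ∈ plusMinus n := by
  simp only [plusMinus, Finset.mem_erase, Finset.mem_Icc] at h ⊢
  omega

instance plusMinusNeg (n : ℕ) : Neg (plusMinus n) :=
  ⟨fun i => ⟨-(i : ℤ), neg_mem_plusMinus i.2⟩⟩

/-- `π` is a signed permutation, i.e. an element of the hyperoctahedral group `B_n`: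
a permutation of `±[n]` with `π (-i) = -π i` for all `i`. -/
def IsSignedPerm {n : ℕ} (π : Equiv.Perm (plusMinus n)) : Prop :=
  ∀ i : plusMinus n, π (-i) = -π i

/-- The letters of the word `π(0) π(1) ⋯ π(n)` of `π`, where `π(0) = 0`
(positions `i > n` are never read). -/
noncomputable def word {n : ℕ} (π : Equiv.Perm (plusMinus n)) (i : ℕ) : ℤ :=
  if h : (i : ℤ) ∈ plusMinus n then (π ⟨(i : ℤ), h⟩ : ℤ) else 0

/-- The subword `w(a) ⋯ w(b)` is monotonic: increasing or decreasing. -/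
def IsMonotonicSubword (w : ℕ → ℤ) (a b : ℕ) : Prop :=
  StrictMonoOn w (Set.Icc a b) ∨ StrictAntiOn w (Set.Icc a b)

/-- `w(a) ⋯ w(b)` (with at least two letters) is a run of the word `w(0) w(1) ⋯ w(n)`:
a maximal consecutive subword that is monotonic. -/
def IsRun (n : ℕ) (w : ℕ → ℤ) (a b : ℕ) : Prop :=
  a < b ∧ b ≤ n ∧ IsMonotonicSubword w a b ∧
    ∀ a' b' : ℕ, a' ≤ a → b ≤ b' → b' ≤ n → IsMonotonicSubword w a' b' → a' = a ∧ b' = b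

open Classical in
/-- The number of runs of the word `w(0) w(1) ⋯ w(n)`. -/
noncomputable def runCount (n : ℕ) (w : ℕ → ℤ) : ℕ :=
  ((Finset.range (n + 1) ×ˢ Finset.range (n + 1)).filter fun p => IsRun n w p.1 p.2).card

open Classical in
/-- `T(n, k)`: the number of up signed permutations in `B_n` (those with `π(1) > 0`)
that have `k` alternating runs. -/
noncomputable def upRunNumber (n k : ℕ) : ℕ :=
  ((Finset.univ : Finset (Equiv.Perm (plusMinus n))).filter fun π =>
    IsSignedPerm π ∧ 0 < word π 1 ∧ runCount n (word π) = k).card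

/-- The type `B` alternating run polynomial `T_n(x) = ∑_{k=1}^n T(n, k) x^k`. -/
noncomputable def altRunPolyB (n : ℕ) : ℚ[X] :=
  ∑ k ∈ Finset.Icc 1 n, (upRunNumber n k : ℚ[X]) * X ^ k

/-- `t_n(x)` for `n ≥ 1`: equal to `(1 + x)(1 - x²)^(k-1)` if `n = 2k - 1`, and to
`-(1 - x²)^k` if `n = 2k`. -/
noncomputable def tPoly (n : ℕ) : ℚ[X] :=
  if Even n then -(1 - X ^ 2) ^ (n / 2) else (1 + X) * (1 - X ^ 2) ^ ((n + 1) / 2 - 1)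

/-! Every signed permutation of size `n + 1` arises uniquely by inserting `n + 1` or `-(n + 1)`
after the initial `0` of one of size `n`. The number of runs is the number of constant blocks in the
list of ascents and descents. The `2n + 2` insertions into a word with `j` blocks contribute
`(2j-1)x^j + 3x^(j+1) + (2n-2j)x^(j+2)`, depending only on `n` and `j`. Hence `T_(n+1) = L_n T_n`
for a first-order differential operator `L_n = runOperator n` (`insertionSum_X_pow_blocks`,
`upSum_succ`, `altRunPolyB_eq_upSum`).

The binomial recurrence follows by induction: `L` obeys a Leibniz rule on the products in the sum
(`runOperator_tQuot_mul`), and Pascal's rule reassembles the result (`altRunPolyB_recurrence`).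

For the multiplicity, `(1+x)^⌊N/2⌋` divides every term of the recurrence for `T_(N+1)`. The cofactor
at `-1` is `2^⌈N/2⌉` times an integer that is odd because the surviving binomial coefficients have
even sum (`altRunPolyB_factorization`). -/

/-! ### Runs and changes of direction -/

theorem isMonotonicSubword_iff {n : ℕ} {w : ℕ → ℤ} (hw : ∀ i < n, w i ≠ w (i + 1)) {a b : ℕ}
    (hb : b ≤ n) :
    IsMonotonicSubword w a b ↔
      ∀ i, a ≤ i → i < b → (w i < w (i + 1) ↔ w a < w (a + 1)) := by
  constructor
  · rintro (h | h) i hai hib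
    · have h1 := h (a := i) (b := i + 1) ⟨hai, hib.le⟩ ⟨by omega, hib⟩ (by omega)
      have h2 := h (a := a) (b := a + 1) ⟨le_rfl, by omega⟩ ⟨by omega, by omega⟩ (by omega)
      simp [h1, h2]
    · have h1 := h (a := i) (b := i + 1) ⟨hai, hib.le⟩ ⟨by omega, hib⟩ (by omega)
      have h2 := h (a := a) (b := a + 1) ⟨le_rfl, by omega⟩ ⟨by omega, by omega⟩ (by omega)
      exact iff_of_false h1.le.not_gt h2.le.not_gt
  · intro h
    by_cases hd : w a < w (a + 1)
    · left
      refine strictMonoOn_of_lt_succ Set.ordConnected_Icc fun i _ hi hi' => ?_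
      simp only [Nat.succ_eq_succ, Nat.succ_eq_add_one, Set.mem_Icc] at hi hi' ⊢
      exact (h i hi.1 (by omega)).2 hd
    · right
      refine strictAntiOn_of_succ_lt Set.ordConnected_Icc fun i _ hi hi' => ?_
      simp only [Nat.succ_eq_succ, Nat.succ_eq_add_one, Set.mem_Icc] at hi hi' ⊢
      have h1 := hw i (by omega)
      have h2 : ¬ w i < w (i + 1) := fun h3 => hd ((h i hi.1 (by omega)).1 h3)
      omega

/-- The step directions before and after position `i + 1` differ. -/
def IsTurn (w : ℕ → ℤ) (i : ℕ) : Prop := ¬ (w i < w (i + 1) ↔ w (i + 1) < w (i + 2))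

/-- Runs are counted by their left endpoints: a monotonic subword extends to the left unless it
starts at `0` or at a turn. -/
theorem exists_isRun_iff {n : ℕ} {w : ℕ → ℤ} (hw : ∀ i < n, w i ≠ w (i + 1)) (a : ℕ) :
    (∃ b, IsRun n w a b) ↔ a < n ∧ (a = 0 ∨ ∃ i, a = i + 1 ∧ IsTurn w i) := by
  constructor
  · rintro ⟨b, hab, hbn, hm, hmax⟩
    refine ⟨by omega, ?_⟩
    rcases a with _ | i
    · simp
    · refine Or.inr ⟨i, rfl, fun ht => ?_⟩
      rw [isMonotonicSubword_iff hw hbn] at hm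
      have := (hmax i b (by omega) le_rfl hbn ((isMonotonicSubword_iff hw hbn).2 ?_)).1
      · omega
      · intro j hj hjb
        rcases hj.eq_or_lt with rfl | hj
        · rfl
        · rw [hm j hj hjb, ht]
  · rintro ⟨han, ha⟩
    classical
    -- The right end of the run is the first later position at which the direction changes, or `n`
    -- if there is none.
    have hex : ∃ b, a < b ∧ (b = n ∨ ¬ (w b < w (b + 1) ↔ w a < w (a + 1))) := ⟨n, han, Or.inl rfl⟩
    obtain ⟨hab, hb⟩ := Nat.find_spec hex
    have hmin := fun m (hm : m < Nat.find hex) => Nat.find_min hex hm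
    have hbn : Nat.find hex ≤ n := Nat.find_min' hex ⟨han, Or.inl rfl⟩
    generalize Nat.find hex = b at *
    refine ⟨b, hab, hbn, (isMonotonicSubword_iff hw hbn).2 ?_, ?_⟩
    · intro i hai hib
      rcases hai.eq_or_lt with rfl | hai
      · rfl
      · have := hmin i hib
        tauto
    · intro a' b' ha' hb' hbn' hm
      rw [isMonotonicSubword_iff hw hbn'] at hm
      have haa : a' = a := by
        by_contra hne
        rcases ha with rfl | ⟨i, rfl, hi⟩
        · omega
        · exact hi ((hm i (by omega) (by omega)).trans (hm (i + 1) (by omega) (by omega)).symm)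
      refine ⟨haa, ?_⟩
      subst haa
      by_contra hne
      rcases hb with rfl | hb
      · omega
      · exact hb (hm b hab.le (by omega))

theorem IsRun.right_unique {n : ℕ} {w : ℕ → ℤ} {a b b' : ℕ} (h : IsRun n w a b)
    (h' : IsRun n w a b') : b = b' := by
  rcases le_total b b' with hb | hb
  · exact (h.2.2.2 a b' le_rfl hb h'.2.1 h'.2.2.1).2.symm
  · exact (h'.2.2.2 a b le_rfl hb h.2.1 h.2.2.1).2

open Classical in
theorem runCount_succ_eq {n : ℕ} {w : ℕ → ℤ} (hw : ∀ i < n + 1, w i ≠ w (i + 1)) :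
    runCount (n + 1) w = (∑ i ∈ Finset.range n, if IsTurn w i then 1 else 0) + 1 := by
  have h1 : runCount (n + 1) w =
      ((Finset.range (n + 1)).filter fun a => a = 0 ∨ ∃ i, a = i + 1 ∧ IsTurn w i).card := by
    unfold runCount
    refine Finset.card_bij (fun p _ => p.1) ?_ ?_ ?_
    · rintro ⟨a, b⟩ h
      have := (exists_isRun_iff hw a).1 ⟨b, (Finset.mem_filter.1 h).2⟩
      simpa using this
    · rintro ⟨a, b⟩ h ⟨a', b'⟩ h' (rfl : a = a')
      exact congrArg (Prod.mk a)
        ((Finset.mem_filter.1 h).2.right_unique (Finset.mem_filter.1 h').2)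
    · intro a ha
      rw [Finset.mem_filter, Finset.mem_range] at ha
      obtain ⟨b, hb⟩ := (exists_isRun_iff hw a).2 ha
      refine ⟨(a, b), ?_, rfl⟩
      have := hb.1
      have := hb.2.1
      simp only [Finset.mem_filter, Finset.mem_product, Finset.mem_range]
      exact ⟨⟨by omega, by omega⟩, hb⟩
  rw [h1, Finset.card_filter, Finset.sum_range_succ']
  simp

/-! ### Step lists and their blocks -/

/-- The ascents (`true`) and descents (`false`) of the word `a :: l`. -/
def steps : ℤ → List ℤ → List Bool
  | _, [] => []
  | a, b :: l => decide (a < b) :: steps b l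

/-- The number of maximal constant blocks of a list. -/
def blocks : List Bool → ℕ
  | [] => 0
  | [_] => 1
  | x :: y :: s => blocks (y :: s) + if x = y then 0 else 1

theorem length_steps (a : ℤ) (l : List ℤ) : (steps a l).length = l.length := by
  induction l generalizing a with
  | nil => rfl
  | cons b l ih => simp [steps, ih]

open Classical in
theorem blocks_steps (n : ℕ) (w : ℕ → ℤ) :
    blocks (steps (w 0) ((List.range (n + 1)).map fun i => w (i + 1))) =
      (∑ i ∈ Finset.range n, if IsTurn w i then 1 else 0) + 1 := by
  induction n generalizing w with
  | zero => simp [steps, blocks]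
  | succ n ih =>
    have h := ih fun i => w (i + 1)
    rw [List.range_succ_eq_map] at h ⊢
    rw [List.range_succ_eq_map, Finset.sum_range_succ']
    simp only [List.map_cons, List.map_map, Function.comp_def, steps, blocks, Nat.succ_eq_add_one,
      zero_add] at h ⊢
    rw [h]
    simp only [IsTurn, decide_eq_decide, zero_add]
    rw [ite_not]
    exact add_right_comm _ _ _

theorem runCount_eq_blocks {n : ℕ} {w : ℕ → ℤ} (hw : ∀ i < n + 1, w i ≠ w (i + 1)) :
    runCount (n + 1) w =
      blocks (steps (w 0) ((List.range (n + 1)).map fun i => w (i + 1))) := by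
  rw [blocks_steps, runCount_succ_eq hw]

theorem blocks_cons_pos (x : Bool) (s : List Bool) : 1 ≤ blocks (x :: s) := by
  induction s generalizing x with
  | nil => simp [blocks]
  | cons y s ih => simp only [blocks]; have := ih y; omega

theorem blocks_le_length (s : List Bool) : blocks s ≤ s.length := by
  induction s with
  | nil => simp [blocks]
  | cons x s ih =>
    cases s with
    | nil => simp [blocks]
    | cons y s =>
      simp only [blocks, List.length_cons] at ih ⊢
      split <;> omega

/-! ### Inserting an extreme letter -/

/-- The step lists obtained by inserting a new largest (`c = true`) or smallest (`c = false`)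
letter, not in front, into a word with step list `s`. -/
def stepInsertions (c : Bool) : List Bool → List (List Bool)
  | [] => [[c]]
  | x :: s => (c :: (!c) :: s) :: (stepInsertions c s).map (List.cons x)

/-- A new maximum replaces the step it interrupts by an ascent followed by a descent; at the end of
the word it appends an ascent. -/
theorem steps_permutations'Aux_max (a m : ℤ) (l : List ℤ) (ha : a < m) (hl : ∀ x ∈ l, x < m) :
    (List.permutations'Aux m l).map (steps a) = stepInsertions true (steps a l) := by
  induction l generalizing a with
  | nil => simp [steps, stepInsertions, ha]
  | cons b l ih =>
    have hb : b < m := hl b (by simp)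
    have := ih b hb fun x hx => hl x (by simp [hx])
    simp [steps, stepInsertions, ha, hb.le, ← this, Function.comp_def]

theorem steps_permutations'Aux_min (a m : ℤ) (l : List ℤ) (ha : m < a) (hl : ∀ x ∈ l, m < x) :
    (List.permutations'Aux m l).map (steps a) = stepInsertions false (steps a l) := by
  induction l generalizing a with
  | nil => simp [steps, stepInsertions, ha.le]
  | cons b l ih =>
    have hb : m < b := hl b (by simp)
    have := ih b hb fun x hx => hl x (by simp [hx])
    simp [steps, stepInsertions, ha.le, hb, ← this, Function.comp_def]

theorem stepInsertions_map_not (c : Bool) (s : List Bool) :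
    stepInsertions c (s.map Bool.not) = (stepInsertions (!c) s).map (List.map Bool.not) := by
  induction s with
  | nil => simp [stepInsertions]
  | cons x s ih => simp [stepInsertions, ih, Function.comp_def]

theorem blocks_map_not (s : List Bool) : blocks (s.map Bool.not) = blocks s := by
  induction s with
  | nil => rfl
  | cons x s ih =>
    cases s with
    | nil => rfl
    | cons y s => simp only [List.map_cons, blocks] at ih ⊢; simp [ih]

/-- The operator that takes the run polynomial of size `n` to that of size `n + 1`. -/
noncomputable def runOperator (n : ℕ) (f : ℚ[X]) : ℚ[X] :=
  2 * (n : ℚ[X]) * X ^ 2 * f + (3 * X - 1) * f + 2 * X * (1 - X ^ 2) * derivative f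

theorem runOperator_add (n : ℕ) (f g : ℚ[X]) :
    runOperator n (f + g) = runOperator n f + runOperator n g := by
  simp only [runOperator, derivative_add]; ring

theorem runOperator_X_pow (n j : ℕ) : runOperator n (X ^ j) =
    (2 * (j : ℚ[X]) - 1) * X ^ j + 3 * X ^ (j + 1) +
      (2 * (n : ℚ[X]) - 2 * (j : ℚ[X])) * X ^ (j + 2) := by
  rcases j with _ | j
  · simp [runOperator]; ring
  · rw [runOperator, derivative_X_pow, Nat.add_sub_cancel, C_eq_natCast]
    push_cast
    ring

/-- The run polynomial of all the step lists obtained from `s` by an insertion. -/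
noncomputable def insertionSum (f : List Bool → ℚ[X]) (s : List Bool) : ℚ[X] :=
  ((stepInsertions true s).map f).sum + ((stepInsertions false s).map f).sum

theorem insertionSum_cons (f : List Bool → ℚ[X]) (x : Bool) (s : List Bool) :
    insertionSum f (x :: s) = f (true :: false :: s) + f (false :: true :: s) +
      insertionSum (fun u => f (x :: u)) s := by
  simp only [insertionSum, stepInsertions, List.map_cons, List.map_map, List.sum_cons,
    Function.comp_def, Bool.not_true, Bool.not_false]
  ring

/-- The effect of an insertion is local. Peeling off two steps leaves the insertions further right,
where the extra leading step `x` only multiplies by `1` or `X`; the induction hypothesis evaluates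
that remainder, and what is left is a finite check on the first three steps. -/
theorem insertionSum_X_pow_blocks (x : Bool) (s : List Bool) :
    insertionSum (fun u => X ^ blocks u) (x :: s) =
      runOperator (s.length + 1) (X ^ blocks (x :: s)) := by
  induction s generalizing x with
  | nil =>
    rw [runOperator_X_pow]
    cases x <;> simp [insertionSum, stepInsertions, blocks] <;> ring
  | cons y s ih =>
    have h := ih y
    rw [insertionSum_cons] at h ⊢
    rw [insertionSum_cons]
    have h2 : insertionSum (fun u => (X : ℚ[X]) ^ blocks (x :: y :: u)) s =
        (if x = y then 1 else X) * insertionSum (fun u => X ^ blocks (y :: u)) s := by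
      unfold insertionSum
      rw [mul_add, ← List.sum_map_mul_left, ← List.sum_map_mul_left]
      congr 3 <;> ext1 u <;> simp only [blocks] <;> split_ifs <;> ring
    rw [h2, ← sub_eq_iff_eq_add'.2 h.symm]
    simp only [runOperator_X_pow]
    cases s with
    | nil => cases x <;> cases y <;> simp [blocks] <;> ring
    | cons z s =>
      cases x <;> cases y <;> cases z <;> simp [blocks] <;> ring

/-! ### Signed permutations as words -/

theorem perm_of_mem_permutations'Aux {α : Type*} {t : α} {l s : List α}
    (h : s ∈ List.permutations'Aux t l) : s.Perm (t :: l) := by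
  induction l generalizing s with
  | nil => simp at h; simp [h]
  | cons y l ih =>
    simp only [List.permutations'Aux, List.mem_cons, List.mem_map] at h
    rcases h with rfl | ⟨u, hu, rfl⟩
    · rfl
    · exact ((ih hu).cons y).trans (List.Perm.swap t y l)

theorem append_cons_mem_permutations'Aux {α : Type*} (t : α) (l₁ l₂ : List α) :
    l₁ ++ t :: l₂ ∈ List.permutations'Aux t (l₁ ++ l₂) := by
  induction l₁ with
  | nil => cases l₂ <;> simp
  | cons y l₁ ih => simp [ih]

theorem filter_of_mem_permutations'Aux {α : Type*} {t : α} {p : α → Bool} (ht : ¬ p t)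
    {l s : List α} (h : s ∈ List.permutations'Aux t l) : s.filter p = l.filter p := by
  induction l generalizing s with
  | nil => simp at h; simp [h, ht]
  | cons y l ih =>
    simp only [List.permutations'Aux, List.mem_cons, List.mem_map] at h
    rcases h with rfl | ⟨u, hu, rfl⟩
    · simp [ht]
    · simp [List.filter_cons, ih hu]

/-- The words `π(1) ⋯ π(n)` of the signed permutations of size `n`. -/
def signedWords : ℕ → List (List ℤ)
  | 0 => [[]]
  | n + 1 => (signedWords n).flatMap fun l =>
      List.permutations'Aux ((n : ℤ) + 1) l ++ List.permutations'Aux (-((n : ℤ) + 1)) l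

theorem mem_signedWords {n : ℕ} {l : List ℤ} :
    l ∈ signedWords n ↔ (l.map Int.natAbs).Perm ((List.range n).map Nat.succ) := by
  induction n generalizing l with
  | zero => simp [signedWords]
  | succ n ih =>
    have hr : ((List.range (n + 1)).map Nat.succ).Perm
        ((n + 1) :: (List.range n).map Nat.succ) := by
      rw [List.range_succ, List.map_append]
      exact List.perm_append_comm
    rw [hr.congr_right, signedWords, List.mem_flatMap]
    constructor
    · rintro ⟨u, hu, hl⟩
      rw [ih] at hu
      have h1 : ∃ m : ℤ, m.natAbs = n + 1 ∧ l ∈ List.permutations'Aux m u := by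
        rcases List.mem_append.1 hl with h | h
        · exact ⟨_, by omega, h⟩
        · exact ⟨_, by omega, h⟩
      obtain ⟨m, hm, h⟩ := h1
      have := (perm_of_mem_permutations'Aux h).map Int.natAbs
      rw [List.map_cons, hm] at this
      exact this.trans (hu.cons _)
    · intro h
      have h1 : n + 1 ∈ l.map Int.natAbs := h.mem_iff.2 (by simp)
      obtain ⟨m, hm, hmn⟩ := List.mem_map.1 h1
      obtain ⟨l₁, l₂, rfl⟩ := List.append_of_mem hm
      refine ⟨l₁ ++ l₂, ?_, ?_⟩
      · rw [ih]
        have h2 := ((List.perm_middle (a := m) (l₁ := l₁) (l₂ := l₂)).map Int.natAbs).symm.trans h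
        rw [List.map_cons, hmn] at h2
        exact h2.cons_inv
      · have h3 := append_cons_mem_permutations'Aux m l₁ l₂
        rw [List.mem_append]
        rcases (show m = (n : ℤ) + 1 ∨ m = -((n : ℤ) + 1) by omega) with rfl | rfl
        · exact Or.inl h3
        · exact Or.inr h3

theorem natAbs_of_mem_signedWords {n : ℕ} {l : List ℤ} (h : l ∈ signedWords n) {x : ℤ}
    (hx : x ∈ l) : 1 ≤ x.natAbs ∧ x.natAbs ≤ n := by
  have := (mem_signedWords.1 h).mem_iff.1 (List.mem_map_of_mem (f := Int.natAbs) hx)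
  simp only [List.mem_map, List.mem_range] at this
  obtain ⟨i, hi, h⟩ := this
  omega

theorem nodup_signedWords (n : ℕ) : (signedWords n).Nodup := by
  induction n with
  | zero => simp [signedWords]
  | succ n ih =>
    rw [signedWords, List.nodup_flatMap]
    constructor
    · intro l hl
      have hb := fun x hx => natAbs_of_mem_signedWords hl (x := x) hx
      have h1 : (n : ℤ) + 1 ∉ l := fun h => by have := hb _ h; omega
      have h2 : -((n : ℤ) + 1) ∉ l := fun h => by have := hb _ h; omega
      refine List.Nodup.append (List.nodup_permutations'Aux_of_notMem _ _ h1)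
        (List.nodup_permutations'Aux_of_notMem _ _ h2) fun s hs hs' => ?_
      have h3 := (perm_of_mem_permutations'Aux hs').mem_iff.1
        ((perm_of_mem_permutations'Aux hs).mem_iff.2 List.mem_cons_self)
      rcases List.mem_cons.1 h3 with h | h
      · omega
      · exact h1 h
    · refine List.Pairwise.imp_of_mem (fun {l l'} hl hl' hne s hs hs' => hne ?_) ih
      -- Deleting the letter of absolute value `n + 1` recovers the word it was inserted into.
      have key : ∀ u ∈ signedWords n,
          s ∈ List.permutations'Aux ((n : ℤ) + 1) u ++ List.permutations'Aux (-((n : ℤ) + 1)) u →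
          s.filter (fun x => x.natAbs ≤ n) = u := by
        intro u hu hsu
        have hfu : u.filter (fun x => x.natAbs ≤ n) = u :=
          List.filter_eq_self.2 fun x hx => by simpa using (natAbs_of_mem_signedWords hu hx).2
        rw [← hfu]
        rcases List.mem_append.1 hsu with h | h
        · rw [filter_of_mem_permutations'Aux (by simp; omega) h]
        · rw [filter_of_mem_permutations'Aux (by simp; omega) h]
      exact (key l hl hs).symm.trans (key l' hl' hs')

/-! ### The differential recurrence for the run polynomial -/

/-- The sum of `f` over the step lists of the words of all signed permutations of size `n`. -/
noncomputable def stepSum (n : ℕ) (f : List Bool → ℚ[X]) : ℚ[X] :=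
  ((signedWords n).map fun l => f (steps 0 l)).sum

theorem List.sum_map_flatMap {α β M : Type*} [AddMonoid M] (l : List α) (g : α → List β)
    (f : β → M) : ((l.flatMap g).map f).sum = (l.map fun a => ((g a).map f).sum).sum := by
  induction l with
  | nil => simp
  | cons a l ih => simp [ih]

theorem stepSum_succ (n : ℕ) (f : List Bool → ℚ[X]) :
    stepSum (n + 1) f = stepSum n (insertionSum f) := by
  unfold stepSum
  rw [signedWords, List.sum_map_flatMap]
  congr 1
  refine List.map_congr_left fun l hl => ?_
  have hb := fun x hx => natAbs_of_mem_signedWords hl (x := x) hx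
  rw [insertionSum, ← steps_permutations'Aux_max 0 ((n : ℤ) + 1) l (by omega)
      (fun x hx => by have := hb x hx; omega),
    ← steps_permutations'Aux_min 0 (-((n : ℤ) + 1)) l (by omega)
      (fun x hx => by have := hb x hx; omega)]
  simp [Function.comp_def]

theorem insertionSum_map_not (f : List Bool → ℚ[X]) (s : List Bool) :
    insertionSum f (s.map Bool.not) = insertionSum (fun u => f (u.map Bool.not)) s := by
  simp only [insertionSum, stepInsertions_map_not, List.map_map, Function.comp_def,
    Bool.not_true, Bool.not_false]
  rw [add_comm]

/-- This is the symmetry `π ↦ -π`, seen on step lists: insertions of the maximum and of the minimum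
are exchanged. -/
theorem stepSum_map_not (n : ℕ) (f : List Bool → ℚ[X]) :
    stepSum n (fun s => f (s.map Bool.not)) = stepSum n f := by
  induction n generalizing f with
  | zero => simp [stepSum, signedWords, steps]
  | succ n ih =>
    rw [stepSum_succ, stepSum_succ, ← ih (insertionSum f)]
    simp only [insertionSum_map_not]

theorem length_of_mem_signedWords {n : ℕ} {l : List ℤ} (h : l ∈ signedWords n) :
    l.length = n := by
  simpa using (mem_signedWords.1 h).length_eq

/-- The run polynomial of the words of the up signed permutations. -/
noncomputable def upSum (n : ℕ) : ℚ[X] :=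
  stepSum n fun s => if s.head? = some true then X ^ blocks s else 0

theorem stepSum_congr {n : ℕ} {f g : List Bool → ℚ[X]} (h : ∀ s, s.length = n → f s = g s) :
    stepSum n f = stepSum n g := by
  unfold stepSum
  congr 1
  refine List.map_congr_left fun l hl => h _ ?_
  rw [length_steps, length_of_mem_signedWords hl]

theorem stepSum_add (n : ℕ) (f g : List Bool → ℚ[X]) :
    stepSum n (fun s => f s + g s) = stepSum n f + stepSum n g := by
  simp [stepSum, List.sum_map_add]

theorem stepSum_X_pow_blocks (n : ℕ) :
    stepSum (n + 1) (fun s => X ^ blocks s) = 2 * upSum (n + 1) := by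
  rw [two_mul]
  nth_rw 2 [upSum]
  rw [← stepSum_map_not (n + 1) fun s => if s.head? = some true then X ^ blocks s else 0, upSum,
    ← stepSum_add]
  refine stepSum_congr fun s hs => ?_
  cases s with
  | nil => simp at hs
  | cons x s =>
    rw [blocks_map_not]
    cases x <;> simp

theorem runOperator_stepSum (m n : ℕ) (f : List Bool → ℚ[X]) :
    stepSum n (fun s => runOperator m (f s)) = runOperator m (stepSum n f) := by
  unfold stepSum
  induction signedWords n with
  | nil => simp [runOperator]
  | cons l ls ih => simp only [List.map_cons, List.sum_cons, ih, runOperator_add]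

theorem upSum_one : upSum 1 = X := by
  simp [upSum, stepSum, signedWords, steps, blocks]

theorem upSum_succ (n : ℕ) : upSum (n + 2) = runOperator (n + 1) (upSum (n + 1)) := by
  have h1 : stepSum (n + 2) (fun s => X ^ blocks s) =
      runOperator (n + 1) (stepSum (n + 1) fun s => X ^ blocks s) := by
    rw [stepSum_succ, ← runOperator_stepSum]
    refine stepSum_congr fun s hs => ?_
    cases s with
    | nil => simp at hs
    | cons x s =>
      rw [insertionSum_X_pow_blocks]
      simp only [List.length_cons] at hs
      rw [hs]
  rw [stepSum_X_pow_blocks, stepSum_X_pow_blocks, two_mul, two_mul, runOperator_add, ← two_mul,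
    ← two_mul] at h1
  exact mul_left_cancel₀ two_ne_zero h1

/-! ### The bijection between signed permutations and words -/

theorem natCast_mem_plusMinus {n i : ℕ} (hi : i < n) : ((i + 1 : ℕ) : ℤ) ∈ plusMinus n := by
  simp only [plusMinus, Finset.mem_erase, Finset.mem_Icc]
  omega

theorem word_zero {n : ℕ} (π : Equiv.Perm (plusMinus n)) : word π 0 = 0 := by
  simp [word, plusMinus]

theorem word_succ {n : ℕ} (π : Equiv.Perm (plusMinus n)) {i : ℕ} (hi : i < n) :
    word π (i + 1) = π ⟨((i + 1 : ℕ) : ℤ), natCast_mem_plusMinus hi⟩ := by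
  rw [word, dif_pos (natCast_mem_plusMinus hi)]

theorem natAbs_bounds_of_mem_plusMinus {n : ℕ} {i : ℤ} (h : i ∈ plusMinus n) :
    1 ≤ i.natAbs ∧ i.natAbs ≤ n := by
  simp only [plusMinus, Finset.mem_erase, Finset.mem_Icc] at h
  omega

theorem coe_neg_plusMinus {n : ℕ} (i : plusMinus n) : ((-i : plusMinus n) : ℤ) = -(i : ℤ) := rfl

theorem natAbs_word_injOn {n : ℕ} {π : Equiv.Perm (plusMinus n)} (hπ : IsSignedPerm π) {i j : ℕ}
    (hi : i < n) (hj : j < n) (h : (word π (i + 1)).natAbs = (word π (j + 1)).natAbs) :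
    i = j := by
  rw [word_succ π hi, word_succ π hj, Int.natAbs_eq_natAbs_iff] at h
  rcases h with h | h
  · have := congrArg Subtype.val (π.injective (Subtype.ext h))
    simpa using this
  · rw [← coe_neg_plusMinus, ← hπ] at h
    have := congrArg Subtype.val (π.injective (Subtype.ext h))
    rw [coe_neg_plusMinus] at this
    simp only at this
    omega

theorem word_ne_succ {n : ℕ} {π : Equiv.Perm (plusMinus n)} (hπ : IsSignedPerm π) :
    ∀ i < n, word π i ≠ word π (i + 1) := by
  intro i hi h
  rcases i with _ | i
  · rw [word_zero, word_succ π hi] at h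
    have := natAbs_bounds_of_mem_plusMinus (π ⟨((0 + 1 : ℕ) : ℤ), natCast_mem_plusMinus hi⟩).2
    omega
  · have := natAbs_word_injOn hπ (by omega) hi (congrArg Int.natAbs h)
    omega

/-- The letters `π(1) ⋯ π(n)`. -/
noncomputable def wordList {n : ℕ} (π : Equiv.Perm (plusMinus n)) : List ℤ :=
  (List.range n).map fun i => word π (i + 1)

theorem wordList_mem_signedWords {n : ℕ} {π : Equiv.Perm (plusMinus n)} (hπ : IsSignedPerm π) :
    wordList π ∈ signedWords n := by
  rw [mem_signedWords]
  have hnd : ((wordList π).map Int.natAbs).Nodup := by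
    rw [wordList, List.map_map]
    refine List.Nodup.map_on (fun i hi j hj h => ?_) List.nodup_range
    exact natAbs_word_injOn hπ (List.mem_range.1 hi) (List.mem_range.1 hj) h
  -- The `n` absolute values are distinct and lie in `{1, …, n}`, so they exhaust it.
  refine (List.subperm_of_subset hnd fun x hx => ?_).perm_of_length_le (by simp [wordList])
  simp only [wordList, List.map_map, List.mem_map, List.mem_range, Function.comp_apply] at hx ⊢
  obtain ⟨i, hi, rfl⟩ := hx
  have h := natAbs_bounds_of_mem_plusMinus (π ⟨((i + 1 : ℕ) : ℤ), natCast_mem_plusMinus hi⟩).2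
  rw [word_succ π hi]
  exact ⟨_, by omega, Nat.sub_add_cancel h.1⟩

theorem exists_eq_or_eq_neg {n : ℕ} (x : plusMinus n) : ∃ (i : ℕ) (hi : i < n),
    x = ⟨((i + 1 : ℕ) : ℤ), natCast_mem_plusMinus hi⟩ ∨
      x = -⟨((i + 1 : ℕ) : ℤ), natCast_mem_plusMinus hi⟩ := by
  have h := natAbs_bounds_of_mem_plusMinus x.2
  refine ⟨(x : ℤ).natAbs - 1, by omega, ?_⟩
  rcases le_total 0 (x : ℤ) with h0 | h0
  · left; ext; simp only; omega
  · right; ext; rw [coe_neg_plusMinus]; simp only; omega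

theorem wordList_injOn {n : ℕ} {π σ : Equiv.Perm (plusMinus n)} (hπ : IsSignedPerm π)
    (hσ : IsSignedPerm σ) (h : wordList π = wordList σ) : π = σ := by
  have key : ∀ (i : ℕ) (hi : i < n), π ⟨((i + 1 : ℕ) : ℤ), natCast_mem_plusMinus hi⟩ =
      σ ⟨((i + 1 : ℕ) : ℤ), natCast_mem_plusMinus hi⟩ := by
    intro i hi
    have := List.map_inj_left.1 h i (List.mem_range.2 hi)
    rw [word_succ π hi, word_succ σ hi] at this
    exact Subtype.ext this
  ext x : 1
  obtain ⟨i, hi, rfl | rfl⟩ := exists_eq_or_eq_neg x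
  · exact key i hi
  · rw [hπ, hσ, key i hi]

theorem exists_wordList_eq {n : ℕ} {l : List ℤ} (hl : l ∈ signedWords n) :
    ∃ π : Equiv.Perm (plusMinus n), IsSignedPerm π ∧ wordList π = l := by
  have hlen := length_of_mem_signedWords hl
  have hnd : (l.map Int.natAbs).Nodup :=
    (mem_signedWords.1 hl).nodup_iff.2 (List.nodup_range.map Nat.succ_injective)
  have hlt : ∀ x : plusMinus n, (x : ℤ).natAbs - 1 < l.length := fun x => by
    have := natAbs_bounds_of_mem_plusMinus x.2; omega
  have hbd : ∀ x : plusMinus n, 1 ≤ (l[(x : ℤ).natAbs - 1]'(hlt x)).natAbs ∧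
      (l[(x : ℤ).natAbs - 1]'(hlt x)).natAbs ≤ n := fun x =>
    natAbs_of_mem_signedWords hl (List.getElem_mem _)
  let f : plusMinus n → plusMinus n := fun x =>
    ⟨if 0 < (x : ℤ) then l[(x : ℤ).natAbs - 1]'(hlt x) else -l[(x : ℤ).natAbs - 1]'(hlt x), by
      have := hbd x
      simp only [plusMinus, Finset.mem_erase, Finset.mem_Icc]
      split_ifs <;> omega⟩
  have hfneg : ∀ x, f (-x) = -f x := by
    intro x
    ext
    have := natAbs_bounds_of_mem_plusMinus x.2
    rw [coe_neg_plusMinus]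
    simp only [f, coe_neg_plusMinus, Int.natAbs_neg]
    split_ifs <;> omega
  have hfabs : ∀ x, (f x : ℤ).natAbs = (l[(x : ℤ).natAbs - 1]'(hlt x)).natAbs := by
    intro x
    simp only [f]
    split_ifs <;> simp
  have hinj : Function.Injective f := by
    intro x y hxy
    have h1 := congrArg (fun z : plusMinus n => (z : ℤ).natAbs) hxy
    simp only [hfabs] at h1
    have h2 : (x : ℤ).natAbs - 1 = (y : ℤ).natAbs - 1 := by
      rw [← hnd.getElem_inj_iff (hi := by simpa using hlt x) (hj := by simpa using hlt y)]
      simpa using h1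
    have hx := natAbs_bounds_of_mem_plusMinus x.2
    have hy := natAbs_bounds_of_mem_plusMinus y.2
    rcases Int.natAbs_eq_natAbs_iff.1 (show (x : ℤ).natAbs = (y : ℤ).natAbs by omega) with h | h
    · exact Subtype.ext h
    -- Here `f y = -f y`, impossible for a nonzero letter.
    · have hx' : x = -y := Subtype.ext h
      rw [hx', hfneg] at hxy
      have h3 := congrArg Subtype.val hxy
      rw [coe_neg_plusMinus] at h3
      have := natAbs_bounds_of_mem_plusMinus (f y).2
      omega
  let π : Equiv.Perm (plusMinus n) := Equiv.ofBijective f (Finite.injective_iff_bijective.1 hinj)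
  refine ⟨π, hfneg, ?_⟩
  refine List.ext_getElem (by simp [wordList, hlen]) fun i h1 h2 => ?_
  have hi : i < n := by omega
  simp only [wordList, List.getElem_map, List.getElem_range]
  rw [word_succ π hi]
  simp only [π, Equiv.ofBijective_apply, f]
  rw [if_pos (by omega)]
  congr 1

theorem runCount_word {n : ℕ} {π : Equiv.Perm (plusMinus (n + 1))} (hπ : IsSignedPerm π) :
    runCount (n + 1) (word π) = blocks (steps 0 (wordList π)) := by
  rw [runCount_eq_blocks (word_ne_succ hπ), word_zero, wordList]

theorem head_steps_wordList {n : ℕ} (π : Equiv.Perm (plusMinus (n + 1))) :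
    (steps 0 (wordList π)).head? = some true ↔ 0 < word π 1 := by
  rw [wordList, List.range_succ_eq_map]
  simp [steps]

open Classical in
theorem altRunPolyB_eq_upSum (n : ℕ) : altRunPolyB (n + 1) = upSum (n + 1) := by
  have h1 : altRunPolyB (n + 1) =
      ∑ π : Equiv.Perm (plusMinus (n + 1)) with IsSignedPerm π ∧ 0 < word π 1,
        (X : ℚ[X]) ^ runCount (n + 1) (word π) := by
    rw [← Finset.sum_fiberwise_of_maps_to (t := Finset.Icc 1 (n + 1))
      (g := fun π => runCount (n + 1) (word π))]
    · refine Finset.sum_congr rfl fun k _ => ?_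
      rw [Finset.sum_congr rfl (g := fun _ => (X : ℚ[X]) ^ k)
        fun π hπ => by rw [(Finset.mem_filter.1 hπ).2]]
      rw [Finset.sum_const, nsmul_eq_mul, Finset.filter_filter, upRunNumber]
      simp only [and_assoc]
    · intro π hπ
      rw [runCount_word (Finset.mem_filter.1 hπ).2.1, Finset.mem_Icc]
      have hlen : (steps 0 (wordList π)).length = n + 1 := by simp [length_steps, wordList]
      refine ⟨?_, (blocks_le_length _).trans hlen.le⟩
      cases h : steps 0 (wordList π) with
      | nil => simp [h] at hlen
      | cons x s => exact blocks_cons_pos x s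
  rw [h1, upSum, stepSum, ← List.sum_toFinset _ (nodup_signedWords _), ← Finset.sum_filter]
  refine Finset.sum_bij (fun π _ => wordList π) ?_ ?_ ?_ ?_
  · intro π hπ
    obtain ⟨-, hs, hu⟩ := Finset.mem_filter.1 hπ
    rw [Finset.mem_filter, List.mem_toFinset, head_steps_wordList]
    exact ⟨wordList_mem_signedWords hs, hu⟩
  · intro π hπ σ hσ
    exact wordList_injOn (Finset.mem_filter.1 hπ).2.1 (Finset.mem_filter.1 hσ).2.1
  · intro l hl
    rw [Finset.mem_filter, List.mem_toFinset] at hl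
    obtain ⟨π, hπ, rfl⟩ := exists_wordList_eq hl.1
    rw [head_steps_wordList] at hl
    exact ⟨π, Finset.mem_filter.2 ⟨Finset.mem_univ _, hπ, hl.2⟩, rfl⟩
  · intro π hπ
    rw [runCount_word (Finset.mem_filter.1 hπ).2.1]

theorem altRunPolyB_one : altRunPolyB 1 = X := by rw [altRunPolyB_eq_upSum, upSum_one]

theorem altRunPolyB_succ (n : ℕ) :
    altRunPolyB (n + 2) = runOperator (n + 1) (altRunPolyB (n + 1)) := by
  rw [altRunPolyB_eq_upSum, altRunPolyB_eq_upSum, upSum_succ]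

/-! ### The binomial recurrence -/

/-- The ratio of consecutive `tPoly`. -/
noncomputable def tRatio (k : ℕ) : ℚ[X] := if Even k then X - 1 else -(1 + X)

/-- The quotient of `tPoly (k + 1)` by `1 + X`. -/
noncomputable def tQuot : ℕ → ℚ[X]
  | 0 => 1
  | k + 1 => tRatio k * tQuot k

theorem tQuot_even_odd (i : ℕ) :
    tQuot (2 * i) = (1 - X ^ 2) ^ i ∧ tQuot (2 * i + 1) = (X - 1) * (1 - X ^ 2) ^ i := by
  induction i with
  | zero => simp [tQuot, tRatio]
  | succ i ih =>
    have h1 : tQuot (2 * (i + 1)) = (1 - X ^ 2) ^ (i + 1) := by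
      rw [mul_add, mul_one, tQuot, ih.2, tRatio, if_neg (by simp)]
      ring
    exact ⟨h1, by rw [tQuot, h1, tRatio, if_pos (by simp)]⟩

theorem tPoly_succ (k : ℕ) : tPoly (k + 1) = (1 + X) * tQuot k := by
  rcases Nat.even_or_odd' k with ⟨i, rfl | rfl⟩
  · rw [(tQuot_even_odd i).1, tPoly, if_neg (by simp)]
    congr 2
    omega
  · rw [(tQuot_even_odd i).2, tPoly, if_pos (by simp [Nat.even_add_one])]
    rw [show (2 * i + 1 + 1) / 2 = i + 1 by omega]
    ring

/-- Up to the term `-2X(1-X)`, which later cancels the derivative of the factor `1 + X`, this turns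
the operator into multiplication by `tRatio k`, hence into the shift from `tQuot k` to `tQuot (k +
1)`. -/
theorem tQuot_differential (k : ℕ) :
    2 * ((k : ℚ[X]) + 1) * X ^ 2 * tQuot k + 2 * X * (1 - X ^ 2) * derivative (tQuot k) =
      (tRatio k + 1 + X - 2 * X * (1 - X)) * tQuot k := by
  induction k with
  | zero => simp [tQuot, tRatio]; ring
  | succ k ih =>
    rw [tQuot, derivative_mul]
    rcases Nat.even_or_odd k with hk | hk
    · have h1 : tRatio k = X - 1 := if_pos hk
      have h2 : tRatio (k + 1) = -(1 + X) := if_neg (by simpa [Nat.even_add_one] using hk)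
      rw [h1] at ih
      rw [h1, h2]
      simp only [derivative_sub, derivative_X, derivative_one]
      push_cast
      linear_combination (X - 1) * ih
    · have h1 : tRatio k = -(1 + X) := if_neg (Nat.not_even_iff_odd.2 hk)
      have h2 : tRatio (k + 1) = X - 1 := if_pos hk.add_one
      rw [h1] at ih
      rw [h1, h2]
      simp only [derivative_add, derivative_neg, derivative_X, derivative_one]
      push_cast
      linear_combination (-(1 + X)) * ih

theorem runOperator_X_mul_tQuot (k : ℕ) : runOperator (k + 1) (X * tQuot k) =
    X * (tRatio k + 2 + 2 * X) * tQuot k := by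
  have h := tQuot_differential k
  rw [runOperator, derivative_mul, derivative_X]
  push_cast
  linear_combination X * h

/-- A Leibniz rule: the size parameter is additive and the derivative part is a derivation, so one
summand raises the index of `tQuot` and another applies the operator to `f`. The constant `c` stands
for a binomial coefficient. -/
theorem runOperator_tQuot_mul (c : ℚ[X]) (hc : derivative c = 0) (k j : ℕ) (f : ℚ[X]) :
    runOperator (k + 1 + (j + 1)) ((1 + X) * (c * tQuot k * f)) =
      (1 + X) * (c * ((tRatio k + 1 + X) * tQuot k * f + tQuot k * runOperator (j + 1) f)) := by
  have h := tQuot_differential k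
  simp only [runOperator, derivative_mul, derivative_add, derivative_X, derivative_one, hc]
  push_cast
  linear_combination ((1 + X) * c * f) * h

theorem runOperator_sum {ι : Type*} (n : ℕ) (s : Finset ι) (f : ι → ℚ[X]) :
    runOperator n (∑ i ∈ s, f i) = ∑ i ∈ s, runOperator n (f i) := by
  simp only [runOperator, derivative_sum, Finset.mul_sum, Finset.sum_add_distrib]

theorem altRunPolyB_recurrence (N : ℕ) : altRunPolyB (N + 1) = X * tQuot N +
    (1 + X) * ∑ j ∈ Finset.range N,
      ((N + 1).choose (j + 1) : ℚ[X]) * tQuot (N - (j + 1)) * altRunPolyB (j + 1) := by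
  induction N with
  | zero => simp [altRunPolyB_one, tQuot]
  | succ N ih =>
    have h1 : altRunPolyB (N + 2) = X * (tRatio N + 2 + 2 * X) * tQuot N +
        (1 + X) * (∑ j ∈ Finset.range N, ((N + 1).choose (j + 1) : ℚ[X]) *
          (tRatio (N - (j + 1)) * tQuot (N - (j + 1)) * altRunPolyB (j + 1)) +
        (1 + X) * ∑ j ∈ Finset.range N, ((N + 1).choose (j + 1) : ℚ[X]) *
          tQuot (N - (j + 1)) * altRunPolyB (j + 1) +
        ∑ j ∈ Finset.range N, ((N + 1).choose (j + 1) : ℚ[X]) *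
          tQuot (N - (j + 1)) * altRunPolyB (j + 2)) := by
      rw [altRunPolyB_succ, ih, runOperator_add, runOperator_X_mul_tQuot, Finset.mul_sum,
        runOperator_sum, ← Finset.sum_add_distrib, ← Finset.sum_add_distrib,
        Finset.mul_sum]
      congr 1
      refine Finset.sum_congr rfl fun j hj => ?_
      have hj := Finset.mem_range.1 hj
      rw [show N + 1 = N - (j + 1) + 1 + (j + 1) by omega, runOperator_tQuot_mul _ (by simp),
        altRunPolyB_succ]
      ring
    -- Pascal's rule splits the new sum. The boundary terms are `tQuot N * X`, from `j = 0`, and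
    -- `altRunPolyB (N + 1)`, from `j = N`.
    have h2 : ∑ j ∈ Finset.range (N + 1), ((N + 1 + 1).choose (j + 1) : ℚ[X]) *
          tQuot (N + 1 - (j + 1)) * altRunPolyB (j + 1) =
        (∑ j ∈ Finset.range N, ((N + 1).choose (j + 1) : ℚ[X]) *
          tQuot (N - (j + 1)) * altRunPolyB (j + 2) + tQuot N * X) +
        (∑ j ∈ Finset.range N, ((N + 1).choose (j + 1) : ℚ[X]) *
          (tRatio (N - (j + 1)) * tQuot (N - (j + 1)) * altRunPolyB (j + 1)) +
          altRunPolyB (N + 1)) := by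
      simp only [Nat.choose_succ_succ (N + 1), Nat.succ_eq_add_one, Nat.cast_add, add_mul,
        Finset.sum_add_distrib, Nat.add_sub_add_right]
      congr 1
      · rw [Finset.sum_range_succ']
        simp [altRunPolyB_one]
      · rw [Finset.sum_range_succ]
        congr 1
        · refine Finset.sum_congr rfl fun j hj => ?_
          have hj := Finset.mem_range.1 hj
          rw [show N - j = N - (j + 1) + 1 by omega, tQuot, mul_assoc]
        · simp [tQuot]
    rw [h2, h1, tQuot]
    -- The induction hypothesis trades the surplus `(1 + X)`-multiple of the old sum for these two
    -- boundary terms.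
    linear_combination (-(1 + X)) * ih

/-! ### Multiplicity of the root `-1` -/

/-- The cofactor of the power of `1 + X` in `tQuot k`. -/
noncomputable def tCofactor (k : ℕ) : ℚ[X] :=
  if Even k then (1 - X) ^ (k / 2) else -(1 - X) ^ (k / 2 + 1)

theorem tQuot_eq_mul_tCofactor (k : ℕ) : tQuot k = (1 + X) ^ (k / 2) * tCofactor k := by
  have h : (1 - X ^ 2 : ℚ[X]) = (1 + X) * (1 - X) := by ring
  rcases Nat.even_or_odd' k with ⟨i, rfl | rfl⟩
  · rw [(tQuot_even_odd i).1, tCofactor, if_pos (by simp), h, mul_pow]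
    rw [Nat.mul_div_cancel_left i two_pos]
  · rw [(tQuot_even_odd i).2, tCofactor, if_neg (by simp), h, mul_pow,
      show (2 * i + 1) / 2 = i by omega]
    ring

theorem eval_tCofactor (k : ℕ) : (tCofactor k).eval (-1) = 2 ^ ((k + 1) / 2) * (-1) ^ k := by
  rcases Nat.even_or_odd' k with ⟨i, rfl | rfl⟩
  · rw [tCofactor, if_pos (by simp), show (2 * i + 1) / 2 = 2 * i / 2 by omega]
    simp
    norm_num
  · rw [tCofactor, if_neg (by simp), show (2 * i + 1 + 1) / 2 = (2 * i + 1) / 2 + 1 by omega]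
    simp [pow_succ]
    norm_num

theorem Finset.sum_range_two_mul {M : Type*} [AddCommMonoid M] (g : ℕ → M) (m : ℕ) :
    ∑ i ∈ Finset.range (2 * m), g i = ∑ i ∈ Finset.range m, (g (2 * i) + g (2 * i + 1)) := by
  induction m with
  | zero => simp
  | succ m ih => rw [mul_add, mul_one, Finset.sum_range_succ, Finset.sum_range_succ, ih,
      Finset.sum_range_succ, add_assoc]

theorem even_sum_choose_inner (N : ℕ) :
    Even (∑ j ∈ Finset.range N, (N + 1).choose (j + 1)) := by
  have h := Nat.sum_range_choose (N + 1)
  rw [Finset.sum_range_succ, Finset.sum_range_succ'] at h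
  simp only [Nat.choose_self, Nat.choose_zero_right, pow_succ] at h
  exact ⟨2 ^ N - 1, by omega⟩

/-- For odd `N = 2m + 1`, Pascal's rule turns the surviving coefficients, at odd `j`, into the full
inner sum of row `2m + 1`, equal to `2^(2m+1) - 2`. -/
theorem even_sum_choose_filter (N : ℕ) :
    Even (∑ j ∈ Finset.range N, if Odd N ∧ Even j then 0 else (N + 1).choose (j + 1)) := by
  rcases Nat.even_or_odd' N with ⟨m, rfl | rfl⟩
  · simpa [← Nat.not_even_iff_odd] using even_sum_choose_inner (2 * m)
  · have h := even_sum_choose_inner (2 * m)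
    rw [Finset.sum_range_two_mul] at h
    rw [Finset.sum_range_succ, Finset.sum_range_two_mul]
    simp only [odd_two_mul_add_one, even_two_mul, and_self, if_true, true_and, zero_add, add_zero,
      Nat.not_even_two_mul_add_one, if_false]
    simpa only [Nat.choose_succ_succ (2 * m + 1), Nat.succ_eq_add_one] using h

/-- Oddness of `z` is what makes the induction close: signs disappear modulo 2, so only the parity
of a sum of binomial coefficients matters. -/
theorem altRunPolyB_factorization (N : ℕ) : ∃ (S : ℚ[X]) (z : ℤ),
    altRunPolyB (N + 1) = (1 + X) ^ (N / 2) * S ∧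
      S.eval (-1) = 2 ^ ((N + 1) / 2) * (z : ℚ) ∧ Odd z := by
  induction N using Nat.strong_induction_on with
  | _ N ih =>
    have ih' : ∀ j, ∃ (S : ℚ[X]) (z : ℤ), j < N → altRunPolyB (j + 1) = (1 + X) ^ (j / 2) * S ∧
        S.eval (-1) = 2 ^ ((j + 1) / 2) * (z : ℚ) ∧ Odd z := by
      intro j
      by_cases hj : j < N
      · obtain ⟨S, z, h⟩ := ih j hj
        exact ⟨S, z, fun _ => h⟩
      -- Dummy values for `j ≥ N`, so that `choose` yields functions on all of `ℕ`.
      · exact ⟨0, 0, fun h => absurd h hj⟩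
    choose S z hS using ih'
    refine ⟨X * tCofactor N + ∑ j ∈ Finset.range N, (1 + X) ^ (if Odd N ∧ Even j then 1 else 0) *
      (((N + 1).choose (j + 1) : ℚ[X]) * tCofactor (N - (j + 1)) * S j),
      -(-1) ^ N + ∑ j ∈ Finset.range N, (if Odd N ∧ Even j then 0 else (N + 1).choose (j + 1) : ℕ) *
        ((-1) ^ (N - (j + 1)) * z j), ?_, ?_, ?_⟩
    · rw [altRunPolyB_recurrence, tQuot_eq_mul_tCofactor, mul_add, Finset.mul_sum, Finset.mul_sum]
      congr 1
      · ring
      · refine Finset.sum_congr rfl fun j hj => ?_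
        have hj := Finset.mem_range.1 hj
        -- For `N` odd and `j` even the floors leave one spare factor `1 + X`, so that term vanishes
        -- at `-1`.
        have he : 1 + (N - (j + 1)) / 2 + j / 2 = N / 2 + if Odd N ∧ Even j then 1 else 0 := by
          simp only [Nat.odd_iff, Nat.even_iff]
          split_ifs <;> omega
        rw [tQuot_eq_mul_tCofactor, (hS j hj).1, ← mul_assoc ((1 + X) ^ (N / 2)), ← pow_add, ← he,
          pow_add, pow_add]
        ring
    · rw [eval_add, eval_mul, eval_X, eval_tCofactor, eval_finsetSum]
      push_cast
      rw [mul_add, Finset.mul_sum]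
      congr 1
      · ring
      · refine Finset.sum_congr rfl fun j hj => ?_
        have hj := Finset.mem_range.1 hj
        by_cases hc : Odd N ∧ Even j
        · simp [hc]
        · have he : (N + 1) / 2 = (N - (j + 1) + 1) / 2 + (j + 1) / 2 := by
            rw [Nat.odd_iff, Nat.even_iff] at hc
            omega
          simp only [hc, if_false, pow_zero, one_mul, eval_mul, eval_natCast, eval_tCofactor,
            (hS j hj).2.1]
          rw [he, pow_add]
          ring
    · rw [← ZMod.intCast_eq_one_iff_odd]
      have h2 : (-1 : ZMod 2) = 1 := by decide
      push_cast
      have h3 := (ZMod.natCast_eq_zero_iff_even).2 (even_sum_choose_filter N)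
      push_cast at h3
      rw [Finset.sum_congr rfl (g := fun j =>
        if Odd N ∧ Even j then 0 else (((N + 1).choose (j + 1) : ℕ) : ZMod 2)), h3]
      · simp [h2]
      · intro j hj
        rw [(ZMod.intCast_eq_one_iff_odd).2 (hS j (Finset.mem_range.1 hj)).2.2]
        simp [h2]

theorem altRunPolyB_ne_zero_and_rootMultiplicity (N : ℕ) : altRunPolyB (N + 1) ≠ 0 ∧
    (altRunPolyB (N + 1)).rootMultiplicity (-1) = N / 2 := by
  obtain ⟨S, z, h1, h2, h3⟩ := altRunPolyB_factorization N
  have hz : S.eval (-1) ≠ 0 := by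
    rw [h2]
    have : z ≠ 0 := by rintro rfl; simp at h3
    positivity
  have hS : S ≠ 0 := by rintro rfl; simp at hz
  have hX : (1 + X : ℚ[X]) = X - C (-1) := by simp [add_comm]
  have h0 : altRunPolyB (N + 1) ≠ 0 := by
    rw [h1, hX]
    exact mul_ne_zero (pow_ne_zero _ (X_sub_C_ne_zero _)) hS
  refine ⟨h0, ?_⟩
  rw [h1, hX] at h0 ⊢
  rw [rootMultiplicity_mul h0, rootMultiplicity_X_sub_C_pow, rootMultiplicity_eq_zero hz, add_zero]

theorem mainTheorem11 (n : ℕ) (hn : 1 ≤ n) :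
    (algebraMap ℚ[X] (RatFunc ℚ) (altRunPolyB n) =
      RatFunc.X / (1 + RatFunc.X) * algebraMap ℚ[X] (RatFunc ℚ) (tPoly n) +
        ∑ r ∈ Finset.Icc 2 n, (n.choose (r - 1) : RatFunc ℚ) *
          algebraMap ℚ[X] (RatFunc ℚ) (tPoly (n - r + 1)) *
          algebraMap ℚ[X] (RatFunc ℚ) (altRunPolyB (r - 1))) ∧
    altRunPolyB n ≠ 0 ∧ (altRunPolyB n).rootMultiplicity (-1) = (n - 1) / 2 := by
  obtain ⟨N, rfl⟩ := Nat.exists_eq_add_of_le' hn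
  refine ⟨?_, altRunPolyB_ne_zero_and_rootMultiplicity N⟩
  have hX : (1 + RatFunc.X : RatFunc ℚ) ≠ 0 := by
    have h : (1 + X : ℚ[X]) ≠ 0 := by
      rw [add_comm, ← C_1]
      exact X_add_C_ne_zero 1
    simpa using (map_ne_zero_iff _ (RatFunc.algebraMap_injective ℚ)).2 h
  rw [altRunPolyB_recurrence N, Finset.mul_sum, map_add, map_sum]
  congr 1
  · rw [tPoly_succ, map_mul, map_mul, map_add, map_one, RatFunc.algebraMap_X]
    field_simp
  · rw [← Finset.Ico_add_one_right_eq_Icc, Finset.sum_Ico_eq_sum_range]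
    refine Finset.sum_congr (by congr 1) fun j hj => ?_
    have hj := Finset.mem_range.1 hj
    rw [show 2 + j - 1 = j + 1 by omega, show N + 1 - (2 + j) = N - (j + 1) by omega, tPoly_succ]
    simp only [map_mul, map_natCast]
    ring
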